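/- Let $\log\Gamma$ denote the analytic branch of the logarithm of the Gamma function on $\mathbb{C}\setminus(-\infty,0]$ that is real on $(0,\infty)$, i.e. with $\log\Gamma(1)=0$, let $\log z$ and $z^{1/2}$ be the principal branches, and let $$J(z)=\log\Gamma(z)-\left(z-\tfrac12\right)\log z+z-\log\sqrt{2\pi}$$ be the Binet function. Let $b,c\in\mathbb{R}$ with $b\ge 0$, and consider the equation $$\frac{J(z^{1/2})}{z^{1/2}}-bz-c=0,\qquad z\neq 0,\quad |\arg z|<\pi .$$ If $b>0$, or if $b=0$ and $c>0$, the equation has exactly one solution, and this solution is real and positive. Otherwise (i.e. if $b=0$ and $c\le 0$) it has no solution. Moreover, $J(z)\neq 0$ for all $z\ne 0$ with $|\arg z|<\pi/2$. -/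

import Mathlib

/-- The analytic branch of `log Γ` on the plane cut along `(-∞, 0]` (star-shaped about `1`)
that vanishes at `1`: the integral of `Γ' / Γ` along the segment from `1` to `z`. -/
noncomputable def logGamma (z : ℂ) : ℂ :=
  ∫ t in (0 : ℝ)..1, (z - 1) * Complex.digamma (1 + (t : ℂ) * (z - 1))

theorem logGamma_one : logGamma 1 = 0 := by
  simp [logGamma]

theorem differentiableOn_digamma_re_pos :
    DifferentiableOn ℂ Complex.digamma {z : ℂ | 0 < z.re} := by
  have hG : DifferentiableOn ℂ Complex.Gamma {z : ℂ | 0 < z.re} := by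
    intro z hz
    refine (Complex.differentiableAt_Gamma z fun m h => ?_).differentiableWithinAt
    have h1 : z.re = -(m : ℝ) := by simp [h]
    have h2 : (0 : ℝ) < z.re := hz
    have h3 : (0 : ℝ) ≤ m := m.cast_nonneg
    linarith
  exact (hG.deriv (isOpen_lt continuous_const Complex.continuous_re)).div hG
    fun z hz => Complex.Gamma_ne_zero_of_re_pos hz

/-- On the right half-plane `logGamma` is an antiderivative of `Γ' / Γ`. -/
theorem hasDerivAt_logGamma {z : ℂ} (hz : 0 < z.re) :
    HasDerivAt logGamma (Complex.digamma z) z := by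
  -- a disc inside the half-plane that contains both `1` and `z`
  obtain ⟨R, hR0, hR1, hRz⟩ : ∃ R : ℝ, 0 < R ∧
      (1 : ℂ) ∈ Metric.ball (R : ℂ) R ∧ z ∈ Metric.ball (R : ℂ) R := by
    have key : ∀ w : ℂ, ∀ R : ℝ, 0 < R → Complex.normSq w < 2 * R * w.re →
        w ∈ Metric.ball (R : ℂ) R := by
      intro w R hR h
      rw [Metric.mem_ball, Complex.dist_eq]
      refine lt_of_pow_lt_pow_left₀ 2 hR.le ?_
      rw [← Complex.normSq_eq_norm_sq]
      simp only [Complex.normSq_apply, Complex.sub_re, Complex.sub_im, Complex.ofReal_re,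
        Complex.ofReal_im] at h ⊢
      nlinarith
    have hn := Complex.normSq_nonneg z
    have hq : 0 ≤ Complex.normSq z / z.re := by positivity
    refine ⟨Complex.normSq z / z.re + 1, by positivity, key _ _ (by positivity) ?_,
      key _ _ (by positivity) ?_⟩
    · simp only [map_one, Complex.one_re]; linarith
    · have : Complex.normSq z / z.re * z.re = Complex.normSq z := div_mul_cancel₀ _ hz.ne'
      nlinarith
  have hsub : Metric.ball (R : ℂ) R ⊆ {w : ℂ | 0 < w.re} := by
    intro w hw
    rw [Metric.mem_ball, Complex.dist_eq] at hw
    have := (abs_le.1 (Complex.abs_re_le_norm (w - R))).1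
    simp only [Complex.sub_re, Complex.ofReal_re] at this
    simp only [Set.mem_ofPred_eq]
    linarith
  have hd := differentiableOn_digamma_re_pos.mono hsub
  obtain ⟨F, hF⟩ := hd.isExactOn_ball
  have heq : ∀ w ∈ Metric.ball (R : ℂ) R, logGamma w = F w - F 1 := by
    intro w hw
    have hmem : ∀ t ∈ Set.uIcc (0 : ℝ) 1, 1 + (t : ℂ) * (w - 1) ∈ Metric.ball (R : ℂ) R := by
      intro t ht
      rw [Set.uIcc_of_le zero_le_one] at ht
      have := (convex_ball (R : ℂ) R).add_smul_sub_mem hR1 hw ht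
      simpa using this
    have hin : ∀ t : ℝ, HasDerivAt (fun t : ℝ => 1 + (t : ℂ) * (w - 1)) (w - 1) t := by
      intro t
      simpa using ((Complex.ofRealCLM.hasDerivAt (x := t)).mul_const (w - 1)).const_add 1
    have hcont : Continuous fun t : ℝ => 1 + (t : ℂ) * (w - 1) := by fun_prop
    rw [logGamma, intervalIntegral.integral_eq_sub_of_hasDerivAt
      (f := fun t : ℝ => F (1 + (t : ℂ) * (w - 1)))]
    · simp
    · intro t ht
      have := (hF _ (hmem t ht)).scomp t (hin t)
      simpa [Function.comp_def] using this
    · apply ContinuousOn.intervalIntegrable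
      exact continuousOn_const.mul (hd.continuousOn.comp hcont.continuousOn hmem)
  refine ((hF z hRz).sub_const (F 1)).congr_of_eventuallyEq ?_
  filter_upwards [Metric.isOpen_ball.mem_nhds hRz] with w hw using heq w hw

/-- On the right half-plane `logGamma` is a logarithm of `Γ`. -/
theorem exp_logGamma {z : ℂ} (hz : 0 < z.re) : Complex.exp (logGamma z) = Complex.Gamma z := by
  have hGd : ∀ w : ℂ, 0 < w.re → DifferentiableAt ℂ Complex.Gamma w := by
    intro w hw
    refine Complex.differentiableAt_Gamma w fun m h => ?_
    have h1 : w.re = -(m : ℝ) := by simp [h]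
    have h3 : (0 : ℝ) ≤ m := m.cast_nonneg
    linarith
  have hder : ∀ w ∈ {w : ℂ | 0 < w.re},
      HasDerivAt (fun w => Complex.Gamma w * Complex.exp (-logGamma w)) 0 w := by
    intro w hw
    have h := (hGd w hw).hasDerivAt.mul ((hasDerivAt_logGamma hw).neg.cexp)
    refine h.congr_deriv ?_
    have hne := Complex.Gamma_ne_zero_of_re_pos hw
    simp only [Pi.neg_apply, Complex.digamma_def, logDeriv_apply]
    field_simp
    ring
  have hconst := (convex_halfSpace_re_gt 0).is_const_of_fderivWithin_eq_zero (𝕜 := ℂ)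
    (f := fun w => Complex.Gamma w * Complex.exp (-logGamma w))
    (fun w hw => (hder w hw).differentiableAt.differentiableWithinAt)
    (fun w hw => by
      have ho : IsOpen {w : ℂ | 0 < w.re} := isOpen_lt continuous_const Complex.continuous_re
      rw [fderivWithin_of_isOpen ho hw, (hder w hw).hasFDerivAt.fderiv]
      ext; simp)
    (x := z) (y := 1) hz (by simp)
  simp only [Complex.Gamma_one, logGamma_one, neg_zero, Complex.exp_zero, mul_one,
    Complex.exp_neg] at hconst
  field_simp at hconst
  exact hconst.symm

/-- The Binet function
`J(z) = log Γ(z) - (z - 1/2) log z + z - log √(2π)`, with the analytic branch of `log Γ` and the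
principal branch of `log z`. -/
noncomputable def binetJ (z : ℂ) : ℂ :=
  logGamma z - (z - 1 / 2) * Complex.log z + z - (Real.log (Real.sqrt (2 * Real.pi)) : ℂ)

/-- The solutions of `J(z^{1/2}) / z^{1/2} - b z - c = 0` in `|arg z| < π`, `z ≠ 0`
(Lean sets `arg 0 = 0`), with the principal square root. -/
def binetSolutions (b c : ℝ) : Set ℂ :=
  {z : ℂ | z ≠ 0 ∧ |z.arg| < Real.pi ∧
    binetJ (z ^ (1 / 2 : ℂ)) / z ^ (1 / 2 : ℂ) - (b : ℂ) * z - (c : ℂ) = 0}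

/-! On the right half-plane the Binet function is a Laplace transform, J(w) = ∫₀^∞ e^{-ws} φ(s) ds
with φ(s) = ∑ 2 / (s² + (2πk)²) > 0 (`binetJ_eq_binetLaplace`). Transforming each term once more
gives, with a = 2πk, J(w)/w = ∑ ∫₀^∞ (2/a) e^{-at} / (w² + t²) dt, a Stieltjes function of z = w².
Its imaginary part is therefore -P · Im z with P > 0 (`binetJ_div_im`).

Taking imaginary parts in the equation gives (P + b) Im z = 0, so every solution is real, and the
cut leaves only z > 0. On the positive axis J(√x)/√x is positive, strictly decreasing, and crosses
the nondecreasing b x + c exactly in the stated cases. A zero of J would likewise have to be a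
positive real, where J > 0.

The Laplace formula holds because both sides satisfy the same difference equation under w ↦ w + 1,
while Euler's limit for Γ and Stirling's formula give exp (J - L) → 1 along w + n, where L is the
Laplace transform. -/

section

open Complex Set Filter Topology MeasureTheory

/-! ### The density and the partial fractions of coth -/

/-- The density of the Laplace representation of `binetJ`:
`∑ 2 / (s² + (2πk)²)` over `k ≥ 1`. -/
noncomputable def binetDensity (s : ℝ) : ℝ :=
  ∑' k : ℕ, 2 / (s ^ 2 + (2 * Real.pi * (k + 1)) ^ 2)

theorem summable_binetDensity_bound :
    Summable fun k : ℕ => 2 / (2 * Real.pi * ((k : ℝ) + 1)) ^ 2 := by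
  have h : Summable fun k : ℕ => 1 / ((k : ℝ) + 1) ^ 2 := by
    have := (summable_nat_add_iff 1).2 (Real.summable_one_div_nat_pow.2 one_lt_two)
    simpa using this
  refine (h.mul_left (2 / (2 * Real.pi) ^ 2)).congr fun k => ?_
  have := Real.pi_pos
  field_simp

theorem binetDensity_term_pos (s : ℝ) (k : ℕ) :
    0 < 2 / (s ^ 2 + (2 * Real.pi * ((k : ℝ) + 1)) ^ 2) := by
  have := Real.pi_pos
  positivity

theorem binetDensity_term_le (s : ℝ) (k : ℕ) :
    2 / (s ^ 2 + (2 * Real.pi * ((k : ℝ) + 1)) ^ 2) ≤ 2 / (2 * Real.pi * ((k : ℝ) + 1)) ^ 2 := by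
  have := Real.pi_pos
  gcongr
  nlinarith [sq_nonneg s]

theorem summable_binetDensity (s : ℝ) :
    Summable fun k : ℕ => 2 / (s ^ 2 + (2 * Real.pi * ((k : ℝ) + 1)) ^ 2) :=
  summable_binetDensity_bound.of_nonneg_of_le (fun k => (binetDensity_term_pos s k).le)
    (binetDensity_term_le s)

theorem binetDensity_pos (s : ℝ) : 0 < binetDensity s :=
  (summable_binetDensity s).tsum_pos (fun k => (binetDensity_term_pos s k).le) 0
    (binetDensity_term_pos s 0)

theorem binetDensity_le (s : ℝ) : binetDensity s ≤ binetDensity 0 := by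
  refine (summable_binetDensity s).tsum_le_tsum (fun k => ?_) (summable_binetDensity 0)
  simpa using binetDensity_term_le s k

theorem continuous_binetDensity : Continuous binetDensity := by
  have := Real.pi_pos
  refine continuous_tsum (fun k => ?_) summable_binetDensity_bound fun k s => ?_
  · refine continuous_const.div (by fun_prop) fun s => ?_
    positivity
  · rw [Real.norm_of_nonneg (binetDensity_term_pos s k).le]
    exact binetDensity_term_le s k

/-- The partial fraction expansion of the hyperbolic cotangent. -/
theorem one_sub_exp_neg_mul_binetDensity {s : ℝ} (hs : 0 < s) :
    (1 - Real.exp (-s)) * binetDensity s =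
      ((1 + Real.exp (-s)) / 2 - (1 - Real.exp (-s)) / s) / s := by
  have hpi := Real.pi_pos
  have hpiC : (Real.pi : ℂ) ≠ 0 := by exact_mod_cast hpi.ne'
  have hsC : (s : ℂ) ≠ 0 := by exact_mod_cast hs.ne'
  -- At this imaginary point the expansion of π cot(πx) becomes that of coth(s/2), and its poles ±k
  -- pair up into the terms of the density.
  set x : ℂ := I * s / (2 * Real.pi) with hx
  have hxim : x.im = s / (2 * Real.pi) := by
    have : x = ((s / (2 * Real.pi) : ℝ) : ℂ) * I := by rw [hx]; push_cast; ring
    rw [this, Complex.mul_I_im, Complex.ofReal_re]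
  have hxZ : x ∈ Complex.integerComplement := by
    rintro ⟨n, hn⟩
    have := congrArg Complex.im hn
    rw [hxim, Complex.intCast_im] at this
    exact (by positivity : 0 < s / (2 * Real.pi)).ne this
  have hcot := cot_series_rep hxZ
  have hterm : ∀ k : ℕ+, (1 / (x - k) + 1 / (x + k) : ℂ) =
      -(2 * Real.pi * I * s) * ((2 / (s ^ 2 + (2 * Real.pi * (k : ℕ)) ^ 2) : ℝ) : ℂ) := by
    intro k
    have h1 : x - k ≠ 0 := fun h => hxZ ⟨k, by simpa using (sub_eq_zero.1 h).symm⟩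
    have h2 : x + k ≠ 0 := fun h => hxZ ⟨-k, by simpa using (eq_neg_of_add_eq_zero_left h).symm⟩
    have h3 : ((s : ℂ) ^ 2 + (2 * Real.pi * (k : ℕ)) ^ 2) ≠ 0 := by
      have : (0 : ℝ) < s ^ 2 + (2 * Real.pi * (k : ℕ)) ^ 2 := by positivity
      exact_mod_cast this.ne'
    have h4 : (x - k) * (x + k) =
        -((s : ℂ) ^ 2 + (2 * Real.pi * (k : ℕ)) ^ 2) / (2 * Real.pi) ^ 2 := by
      rw [hx]; field_simp; ring_nf; simp only [I_sq]; ring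
    have h5 : (1 / (x - k) + 1 / (x + k) : ℂ) = 2 * x / ((x - k) * (x + k)) := by
      field_simp; ring
    rw [h5, h4, hx]
    push_cast
    field_simp
  simp_rw [hterm] at hcot
  rw [tsum_mul_left, ← Complex.ofReal_tsum,
    tsum_pnat_eq_tsum_succ (f := fun k : ℕ => 2 / (s ^ 2 + (2 * Real.pi * (k : ℝ)) ^ 2))] at hcot
  simp only [Nat.cast_add, Nat.cast_one] at hcot
  rw [← binetDensity] at hcot
  have hcotval : Complex.cot (Real.pi * x) * (1 - Real.exp (-s)) = -I * (1 + Real.exp (-s)) := by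
    have he : Real.pi * x = I * (s / 2) := by rw [hx]; field_simp
    have hexp : Complex.exp (2 * I * (Real.pi * x)) = Real.exp (-s) := by
      rw [he]; push_cast; congr 1; ring_nf; simp
    rw [Complex.cot_eq_exp_ratio, hexp]
    have hlt : Real.exp (-s) < 1 := by simpa using hs
    have : (1 - (Real.exp (-s) : ℂ)) ≠ 0 := by
      rw [sub_ne_zero]; exact_mod_cast hlt.ne'
    have hI : I ≠ 0 := I_ne_zero
    field_simp
    ring_nf; simp [add_comm]
  have hfin : (((1 - Real.exp (-s)) * binetDensity s : ℝ) : ℂ) =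
      (((1 + Real.exp (-s)) / 2 - (1 - Real.exp (-s)) / s) / s : ℝ) := by
    have hinv : 1 / x = -(2 * Real.pi * I) / s := by
      rw [hx]; field_simp; simp
    rw [hinv] at hcot
    push_cast at hcotval hcot ⊢
    have h := congrArg (fun z => z * (1 - Complex.exp (-s))) hcot
    simp only [mul_assoc, hcotval] at h
    have hI : I ≠ 0 := I_ne_zero
    field_simp at h ⊢
    linear_combination h
  exact_mod_cast hfin

/-! ### The Laplace transform: convergence, decay, holomorphy -/

/-- The Laplace transform of `binetDensity`. -/
noncomputable def binetLaplace (w : ℂ) : ℂ :=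
  ∫ s in Ioi (0 : ℝ), Complex.exp (-w * s) * (binetDensity s : ℂ)

theorem norm_exp_neg_mul_ofReal (w : ℂ) (s : ℝ) :
    ‖Complex.exp (-w * s)‖ = Real.exp (-w.re * s) := by
  simp [Complex.norm_exp]

theorem norm_binetLaplace_integrand_le (w : ℂ) (s : ℝ) :
    ‖Complex.exp (-w * s) * (binetDensity s : ℂ)‖ ≤ Real.exp (-w.re * s) * binetDensity 0 := by
  rw [norm_mul, norm_exp_neg_mul_ofReal, Complex.norm_of_nonneg (binetDensity_pos s).le]
  gcongr
  exact binetDensity_le s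

theorem continuous_binetLaplace_integrand (w : ℂ) :
    Continuous fun s : ℝ => Complex.exp (-w * s) * (binetDensity s : ℂ) := by
  have := continuous_binetDensity
  fun_prop

theorem integrableOn_binetLaplace {w : ℂ} (hw : 0 < w.re) :
    IntegrableOn (fun s : ℝ => Complex.exp (-w * s) * (binetDensity s : ℂ)) (Ioi 0) :=
  ((integrableOn_exp_mul_Ioi (neg_lt_zero.2 hw) 0).mul_const (binetDensity 0)).mono'
    (continuous_binetLaplace_integrand w).aestronglyMeasurable
    (.of_forall (norm_binetLaplace_integrand_le w))

theorem norm_binetLaplace_le {w : ℂ} (hw : 0 < w.re) :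
    ‖binetLaplace w‖ ≤ binetDensity 0 / w.re := by
  refine (norm_integral_le_of_norm_le
    ((integrableOn_exp_mul_Ioi (neg_lt_zero.2 hw) 0).mul_const (binetDensity 0))
    (.of_forall (norm_binetLaplace_integrand_le w))).trans_eq ?_
  rw [integral_mul_const, integral_exp_mul_Ioi (neg_lt_zero.2 hw)]
  simp; field_simp

theorem tendsto_binetLaplace_add_nat {w : ℂ} (hw : 0 < w.re) :
    Tendsto (fun n : ℕ => binetLaplace (w + n)) atTop (𝓝 0) := by
  have h : Tendsto (fun n : ℕ => binetDensity 0 / (w.re + n)) atTop (𝓝 0) :=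
    tendsto_const_nhds.div_atTop
      (tendsto_atTop_add_const_left _ _ tendsto_natCast_atTop_atTop)
  refine squeeze_zero_norm (fun n => ?_) h
  have h1 : (w + n).re = w.re + n := by simp
  have := norm_binetLaplace_le (w := w + n) (by rw [h1]; positivity)
  rwa [h1] at this

theorem differentiableAt_binetLaplace {w : ℂ} (hw : 0 < w.re) :
    DifferentiableAt ℂ binetLaplace w := by
  have hs : {v : ℂ | w.re / 2 < v.re} ∈ 𝓝 w :=
    (isOpen_lt continuous_const Complex.continuous_re).mem_nhds (by simp; linarith)
  have hb : IntegrableOn (fun s : ℝ => s * Real.exp (-(w.re / 2) * s) * binetDensity 0)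
      (Ioi 0) := by
    have := integrableOn_rpow_mul_exp_neg_mul_rpow (p := 1) (s := 1) (b := w.re / 2)
      (by norm_num) one_pos (by linarith)
    simp only [Real.rpow_one] at this
    exact this.mul_const _
  have hφ := continuous_binetDensity
  refine (hasDerivAt_integral_of_dominated_loc_of_deriv_le
    (F := fun v (s : ℝ) => Complex.exp (-v * s) * (binetDensity s : ℂ))
    (F' := fun v (s : ℝ) => Complex.exp (-v * s) * (-1 * s) * (binetDensity s : ℂ)) hs
    (.of_forall fun v => (continuous_binetLaplace_integrand v).aestronglyMeasurable)
    (integrableOn_binetLaplace hw) ?_ ?_ hb ?_).2.differentiableAt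
  · exact Continuous.aestronglyMeasurable (by fun_prop)
  · filter_upwards [ae_restrict_mem measurableSet_Ioi] with s hs v hv
    have hs0 : 0 < s := hs
    have hv' : w.re / 2 < v.re := hv
    rw [norm_mul, norm_mul, norm_exp_neg_mul_ofReal, Complex.norm_of_nonneg (binetDensity_pos s).le]
    have : ‖(-1 * s : ℂ)‖ = s := by simp [abs_of_pos hs0]
    rw [this, mul_comm s]
    gcongr
    · exact (binetDensity_pos s).le
    · exact binetDensity_le s
  · refine .of_forall fun s v _ => ?_
    exact (((hasDerivAt_id v).neg.mul_const (s : ℂ)).cexp).mul_const _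

/-! ### The difference equation of the Laplace transform -/

theorem add_ofReal_mem_slitPlane {w : ℂ} (hw : 0 < w.re) {u : ℝ} (hu : 0 ≤ u) :
    w + u ∈ slitPlane := Or.inl (by simp; linarith)

theorem integral_half_sub_div_add {w : ℂ} (hw : 0 < w.re) :
    ∫ u in (0 : ℝ)..1, (1 / 2 - (u : ℂ)) / (w + u) =
      (w + 1 / 2) * (Complex.log (w + 1) - Complex.log w) - 1 := by
  have hne : ∀ u ∈ uIcc (0 : ℝ) 1, w + u ∈ slitPlane := fun u hu => by
    rw [uIcc_of_le zero_le_one] at hu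
    exact add_ofReal_mem_slitPlane hw hu.1
  rw [intervalIntegral.integral_eq_sub_of_hasDerivAt
    (f := fun u : ℝ => (w + 1 / 2) * Complex.log (w + u) - u)]
  · simp; ring
  · intro u hu
    have h1 : HasDerivAt (fun u : ℝ => w + (u : ℂ)) 1 u := Complex.ofRealCLM.hasDerivAt.const_add w
    have h2 : HasDerivAt (fun u : ℝ => (u : ℂ)) 1 u := Complex.ofRealCLM.hasDerivAt
    refine (((h1.clog_real (hne u hu)).const_mul (w + 1 / 2)).sub h2).congr_deriv ?_
    have := slitPlane_ne_zero (hne u hu)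
    field_simp
    ring
  · refine ContinuousOn.intervalIntegrable ?_
    refine ContinuousOn.div (by fun_prop) (by fun_prop) fun u hu => slitPlane_ne_zero (hne u hu)

/-- The right side is (1 - e^{-s}) φ(s) by the coth expansion, so the density of L(w) - L(w + 1) is
itself an integral over [0, 1]. -/
theorem integral_half_sub_mul_exp {s : ℝ} (hs : 0 < s) :
    ∫ u in (0 : ℝ)..1, (1 / 2 - u) * Real.exp (-s * u) =
      ((1 + Real.exp (-s)) / 2 - (1 - Real.exp (-s)) / s) / s := by
  rw [intervalIntegral.integral_eq_sub_of_hasDerivAt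
    (f := fun u : ℝ => Real.exp (-s * u) * (1 / s ^ 2 - (1 / 2 - u) / s))]
  · simp; field_simp; ring
  · intro u _
    have h1 : HasDerivAt (fun u : ℝ => Real.exp (-s * u)) (Real.exp (-s * u) * (-s * 1)) u :=
      ((hasDerivAt_id u).const_mul (-s)).exp
    have h2 : HasDerivAt (fun u : ℝ => 1 / s ^ 2 - (1 / 2 - u) / s) (-(-1 / s)) u :=
      (((hasDerivAt_id u).const_sub (1 / 2)).div_const s).const_sub _
    refine (h1.mul h2).congr_deriv ?_
    field_simp
    ring
  · exact Continuous.intervalIntegrable (by fun_prop) _ _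

/-- Shifting w by 1 multiplies the density by e^{-s}; writing (1 - e^{-s}) φ(s) as ∫₀¹ (1/2 - u)
e^{-su} du and swapping integrals leaves the elementary ∫₀¹ (1/2 - u) / (w + u) du. -/
theorem binetLaplace_sub_binetLaplace_add_one {w : ℂ} (hw : 0 < w.re) :
    binetLaplace w - binetLaplace (w + 1) =
      (w + 1 / 2) * (Complex.log (w + 1) - Complex.log w) - 1 := by
  have hw1 : 0 < (w + 1).re := by simp; linarith
  have h1 : binetLaplace w - binetLaplace (w + 1) =
      ∫ s in Ioi (0 : ℝ), ∫ u in (0 : ℝ)..1,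
        (1 / 2 - (u : ℂ)) * Complex.exp (-(w + u) * s) := by
    rw [binetLaplace, binetLaplace, ← integral_sub (integrableOn_binetLaplace hw)
      (integrableOn_binetLaplace hw1)]
    refine setIntegral_congr_fun measurableSet_Ioi fun s hs => ?_
    have e1 : ∀ u : ℝ, (1 / 2 - (u : ℂ)) * Complex.exp (-(w + u) * s) =
        Complex.exp (-w * s) * (((1 / 2 - u) * Real.exp (-s * u) : ℝ) : ℂ) := by
      intro u
      rw [show -(w + u) * s = -w * s + -s * u by ring, Complex.exp_add]
      push_cast; ring
    simp only [e1]
    rw [intervalIntegral.integral_const_mul, intervalIntegral.integral_ofReal,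
      integral_half_sub_mul_exp hs, ← one_sub_exp_neg_mul_binetDensity hs,
      show -(w + 1) * (s : ℂ) = -w * s + -s by ring, Complex.exp_add]
    push_cast; ring
  rw [h1, ← integral_half_sub_div_add hw, ← intervalIntegral_integral_swap]
  · refine intervalIntegral.integral_congr fun u hu => ?_
    rw [uIcc_of_le zero_le_one] at hu
    have h2 : (-(w + u)).re < 0 := by simp; linarith [hu.1]
    have h3 : w + u ≠ 0 := slitPlane_ne_zero (add_ofReal_mem_slitPlane hw hu.1)
    simp only [integral_const_mul, integral_exp_mul_complex_Ioi h2]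
    have h4 : (1 / 2 - (u : ℂ)) * (-Complex.exp (-(w + u) * (0 : ℝ)) / -(w + u)) =
        (1 / 2 - (u : ℂ)) / (w + u) := by
      rw [neg_div_neg_eq]; simp [div_eq_mul_inv]
    exact h4
  · have hfin : IsFiniteMeasure (volume.restrict (uIoc (0 : ℝ) 1)) := by
      rw [uIoc_of_le zero_le_one]; infer_instance
    have hd : Integrable (fun p : ℝ × ℝ => (1 : ℝ) * Real.exp (-w.re * p.2))
        ((volume.restrict (uIoc (0 : ℝ) 1)).prod (volume.restrict (Ioi 0))) :=
      Integrable.mul_prod (f := fun _ : ℝ => (1 : ℝ)) (integrable_const _)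
        (integrableOn_exp_mul_Ioi (neg_lt_zero.2 hw) 0)
    refine hd.mono' (Continuous.aestronglyMeasurable (by fun_prop)) ?_
    rw [Measure.prod_restrict]
    filter_upwards [ae_restrict_mem (measurableSet_uIoc.prod measurableSet_Ioi)] with p hp
    obtain ⟨hp1, hp2⟩ := hp
    rw [uIoc_of_le zero_le_one] at hp1
    have hp2' : 0 < p.2 := hp2
    simp only [Function.uncurry]
    rw [norm_mul, norm_exp_neg_mul_ofReal]
    have : ‖(1 / 2 - (p.1 : ℂ))‖ ≤ 1 := by
      rw [show (1 / 2 - (p.1 : ℂ)) = ((1 / 2 - p.1 : ℝ) : ℂ) by push_cast; ring, Complex.norm_real,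
        Real.norm_eq_abs, abs_le]
      constructor <;> linarith [hp1.1, hp1.2]
    have h4 : w.re ≤ (w + p.1).re := by simp; exact hp1.1.le
    gcongr

/-! ### Identification of J with the Laplace transform -/

theorem binetJ_sub_binetLaplace_eq (w : ℂ) : binetJ w - binetLaplace w =
    logGamma w + (-(w - 1 / 2) * Complex.log w + w -
      (Real.log (Real.sqrt (2 * Real.pi)) : ℂ) - binetLaplace w) := by
  rw [binetJ]; ring

/-- Exponentials turn `logGamma` into Γ, so Γ(w + 1) = w Γ(w) applies with no branch of the
logarithm to track. -/
theorem exp_binetJ_sub_binetLaplace_add_one {w : ℂ} (hw : 0 < w.re) :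
    Complex.exp (binetJ (w + 1) - binetLaplace (w + 1)) =
      Complex.exp (binetJ w - binetLaplace w) := by
  have hw1 : 0 < (w + 1).re := by simp; linarith
  have hw0 : w ≠ 0 := by rintro rfl; simp at hw
  rw [binetJ_sub_binetLaplace_eq, binetJ_sub_binetLaplace_eq, Complex.exp_add (logGamma (w + 1)),
    exp_logGamma hw1, Complex.Gamma_add_one w hw0, ← exp_logGamma hw]
  nth_rw 1 [← Complex.exp_log hw0]
  rw [← Complex.exp_add, ← Complex.exp_add]
  congr 1
  linear_combination binetLaplace_sub_binetLaplace_add_one hw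

theorem exp_binetJ_sub_binetLaplace_add_nat {w : ℂ} (hw : 0 < w.re) (n : ℕ) :
    Complex.exp (binetJ (w + n) - binetLaplace (w + n)) =
      Complex.exp (binetJ w - binetLaplace w) := by
  induction n with
  | zero => simp
  | succ n ih =>
    have h : 0 < (w + n).re := by simp; positivity
    rw [← ih, ← exp_binetJ_sub_binetLaplace_add_one h]
    push_cast
    rw [add_assoc]

theorem Gamma_add_nat_eq_prod {w : ℂ} (hw : 0 < w.re) (n : ℕ) :
    Complex.Gamma (w + n) = Complex.Gamma w * ∏ j ∈ Finset.range n, (w + j) := by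
  induction n with
  | zero => simp
  | succ n ih =>
    have h : w + n ≠ 0 := by
      intro h
      have := congrArg Complex.re h
      simp only [Complex.add_re, Complex.natCast_re, Complex.zero_re] at this
      have hn : (0 : ℝ) ≤ n := n.cast_nonneg
      linarith
    rw [Finset.prod_range_succ, Nat.cast_succ, ← add_assoc, Complex.Gamma_add_one _ h, ih]
    ring

/-- Each of the three factors tends to 1: by Euler's limit, by Stirling's formula, and by n log(1 +
(w + 1)/n) → w + 1. The shift is n + 1 because `GammaSeq w n` has the n + 1 factors w, …, w + n in
its denominator. -/
theorem exp_binetJ_sub_binetLaplace_eq_seq {w : ℂ} (hw : 0 < w.re) {n : ℕ} (hn : 0 < n) :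
    Complex.exp (binetJ (w + (n + 1 : ℕ)) - binetLaplace (w + (n + 1 : ℕ))) =
      Complex.Gamma w / Complex.GammaSeq w n * ((Stirling.stirlingSeq n / Real.sqrt Real.pi : ℝ) : ℂ)
        * Complex.exp (-((w + 1 / 2) * Complex.log (1 + (w + 1) / n) +
          n * Complex.log (1 + (w + 1) / n)) + (w + 1) - binetLaplace (w + (n + 1 : ℕ))) := by
  have hpi := Real.pi_pos
  have hnR : (0 : ℝ) < n := by exact_mod_cast hn
  have hnC : (n : ℂ) ≠ 0 := by exact_mod_cast hn.ne'
  have hre : 0 < (w + (n + 1 : ℕ)).re := by simp; positivity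
  have hprod : ∏ j ∈ Finset.range (n + 1), (w + j) ≠ 0 := by
    refine Finset.prod_ne_zero_iff.2 fun j _ h => ?_
    have := congrArg Complex.re h
    simp at this
    have hj : (0 : ℝ) ≤ j := j.cast_nonneg
    linarith
  -- Stirling's approximation √(2πn) (n/e)ⁿ in exponential form; its log √(2π) cancels the constant
  -- in J.
  have hfact : (n.factorial : ℝ) =
      Stirling.stirlingSeq n / Real.sqrt Real.pi * Real.exp (Real.log (Real.sqrt (2 * Real.pi)) +
        Real.log n / 2 + n * Real.log n - n) := by
    have e1 : Real.exp (Real.log n / 2) = Real.sqrt n := by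
      rw [Real.sqrt_eq_rpow, Real.rpow_def_of_pos hnR]; ring_nf
    have e2 : Real.exp (n * Real.log n) = (n : ℝ) ^ n := by
      rw [Real.exp_nat_mul, Real.exp_log hnR]
    have e3 : Real.exp n = Real.exp 1 ^ n := by rw [← Real.exp_nat_mul, mul_one]
    have hs : Real.sqrt n ≠ 0 := (Real.sqrt_pos.2 hnR).ne'
    have hsp : Real.sqrt Real.pi ≠ 0 := (Real.sqrt_pos.2 hpi).ne'
    rw [Real.exp_sub, Real.exp_add, Real.exp_add, Real.exp_log (by positivity), e1, e2, e3,
      Stirling.stirlingSeq, Real.sqrt_mul zero_le_two, Real.sqrt_mul zero_le_two, div_pow]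
    field_simp
  have hlog : Complex.log (w + (n + 1 : ℕ)) = Real.log n + Complex.log (1 + (w + 1) / n) := by
    have h1 : w + (n + 1 : ℕ) = ((n : ℝ) : ℂ) * (1 + (w + 1) / n) := by
      push_cast; field_simp; ring
    have h2 : (1 + (w + 1) / n) ≠ 0 := by
      intro h
      rw [h, mul_zero] at h1
      rw [h1] at hre
      simp at hre
    rw [h1, Complex.log_ofReal_mul hnR h2]
  have hGs : Complex.GammaSeq w n ≠ 0 := by
    rw [Complex.GammaSeq]
    have : (n.factorial : ℂ) ≠ 0 := by exact_mod_cast n.factorial_ne_zero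
    have : (n : ℂ) ^ w ≠ 0 := by simp [Complex.cpow_eq_zero_iff, hnC]
    positivity
  have hG : Complex.Gamma (w + (n + 1 : ℕ)) = Complex.Gamma w / Complex.GammaSeq w n *
      (Complex.exp (Real.log n * w) * (n.factorial : ℂ)) := by
    have : Complex.exp (Real.log n * w) * (n.factorial : ℂ) =
        Complex.GammaSeq w n * ∏ j ∈ Finset.range (n + 1), (w + j) := by
      rw [Complex.GammaSeq, div_mul_cancel₀ _ hprod, Complex.cpow_def_of_ne_zero hnC,
        Complex.natCast_log]
    rw [Gamma_add_nat_eq_prod hw, this]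
    field_simp
  rw [binetJ_sub_binetLaplace_eq, Complex.exp_add, exp_logGamma hre, hG, hlog]
  have hfactC : (n.factorial : ℂ) = ((n.factorial : ℝ) : ℂ) := by push_cast; rfl
  rw [hfactC, hfact, Complex.ofReal_mul, Complex.ofReal_exp]
  have key : ∀ a b x y z t : ℂ, x + y + z = t →
      a * (Complex.exp x * (b * Complex.exp y)) * Complex.exp z = a * b * Complex.exp t := by
    intro a b x y z t h
    rw [← h, Complex.exp_add, Complex.exp_add]; ring
  refine key _ _ _ _ _ _ ?_
  push_cast
  ring

theorem exp_binetJ_sub_binetLaplace {w : ℂ} (hw : 0 < w.re) :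
    Complex.exp (binetJ w - binetLaplace w) = 1 := by
  have hpi := Real.pi_pos
  have hG := Complex.Gamma_ne_zero_of_re_pos hw
  have h1 : Tendsto (fun n : ℕ => Complex.Gamma w / Complex.GammaSeq w n) atTop (𝓝 1) := by
    have := (tendsto_const_nhds (x := Complex.Gamma w)).div
      (Complex.GammaSeq_tendsto_Gamma w) hG
    rwa [div_self hG] at this
  have h2 : Tendsto (fun n : ℕ => ((Stirling.stirlingSeq n / Real.sqrt Real.pi : ℝ) : ℂ)) atTop
      (𝓝 1) := by
    have := Stirling.tendsto_stirlingSeq_sqrt_pi.div_const (Real.sqrt Real.pi)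
    rw [div_self (Real.sqrt_pos.2 hpi).ne'] at this
    exact_mod_cast (Complex.continuous_ofReal.tendsto 1).comp this
  have hcast : Tendsto (fun n : ℕ => (w + 1) / (n : ℂ)) atTop (𝓝 0) :=
    tendsto_const_div_atTop_nhds_zero_nat _
  have h3 : Tendsto (fun n : ℕ => Complex.log (1 + (w + 1) / n)) atTop (𝓝 0) := by
    have := (continuousAt_clog (x := 1) (by simp)).tendsto.comp
      (f := fun n : ℕ => 1 + (w + 1) / (n : ℂ)) (by simpa using hcast.const_add 1)
    simpa [Function.comp_def] using this
  have h4 : Tendsto (fun n : ℕ => (n : ℂ) * Complex.log (1 + (w + 1) / n)) atTop (𝓝 (w + 1)) := by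
    refine Complex.tendsto_nat_mul_log_one_add_of_tendsto ?_
    refine tendsto_const_nhds.congr' ?_
    filter_upwards [eventually_gt_atTop 0] with n hn
    have : (n : ℂ) ≠ 0 := by exact_mod_cast hn.ne'
    field_simp
  have h5 : Tendsto (fun n : ℕ => binetLaplace (w + (n + 1 : ℕ))) atTop (𝓝 0) :=
    (tendsto_binetLaplace_add_nat hw).comp (tendsto_add_atTop_nat 1)
  have h6 := (h1.mul h2).mul ((Complex.continuous_exp.tendsto _).comp
    ((((h3.const_mul (w + 1 / 2)).add h4).neg.add_const (w + 1)).sub h5))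
  have h7 : (1 : ℂ) * 1 * Complex.exp (-((w + 1 / 2) * 0 + (w + 1)) + (w + 1) - 0) = 1 := by simp
  rw [h7] at h6
  refine tendsto_nhds_unique (tendsto_const_nhds.congr' ?_) h6
  filter_upwards [eventually_gt_atTop 0] with n hn
  rw [Function.comp_apply, ← exp_binetJ_sub_binetLaplace_eq_seq hw hn,
    exp_binetJ_sub_binetLaplace_add_nat hw]

theorem differentiableAt_binetJ {w : ℂ} (hw : 0 < w.re) : DifferentiableAt ℂ binetJ w := by
  have h1 := (hasDerivAt_logGamma hw).differentiableAt
  have h2 : DifferentiableAt ℂ Complex.log w := differentiableAt_log (Or.inl hw)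
  unfold binetJ
  fun_prop

/-- The Laplace transform of `binetDensity` on the positive reals. -/
noncomputable def realBinetLaplace (x : ℝ) : ℝ :=
  ∫ s in Ioi (0 : ℝ), Real.exp (-x * s) * binetDensity s

theorem binetLaplace_ofReal (x : ℝ) : binetLaplace x = (realBinetLaplace x : ℂ) := by
  rw [binetLaplace, realBinetLaplace, ← integral_complex_ofReal]
  push_cast
  rfl

/-- Since exp (J - L) is identically 1, J - L has zero derivative and is constant on the half-plane.
At w = 1 it is real, and a real number with exponential 1 is 0, which rules out a multiple of 2πi.
-/
theorem binetJ_eq_binetLaplace {w : ℂ} (hw : 0 < w.re) : binetJ w = binetLaplace w := by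
  have hD : ∀ v : ℂ, 0 < v.re → HasDerivAt (fun v => binetJ v - binetLaplace v) 0 v := by
    intro v hv
    have h1 := ((differentiableAt_binetJ hv).sub (differentiableAt_binetLaplace hv)).hasDerivAt
    have h2 := h1.cexp
    have h3 : (fun v => Complex.exp ((binetJ - binetLaplace) v)) =ᶠ[𝓝 v] fun _ => 1 := by
      filter_upwards [(isOpen_lt continuous_const Complex.continuous_re).mem_nhds hv] with u hu
      exact exp_binetJ_sub_binetLaplace hu
    have h4 := h2.unique ((hasDerivAt_const v (1 : ℂ)).congr_of_eventuallyEq h3)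
    rw [(mul_eq_zero.1 h4).resolve_left (Complex.exp_ne_zero _)] at h1
    exact h1
  have hconst := (convex_halfSpace_re_gt 0).is_const_of_fderivWithin_eq_zero (𝕜 := ℂ)
    (f := fun v => binetJ v - binetLaplace v)
    (fun v hv => (hD v hv).differentiableAt.differentiableWithinAt)
    (fun v hv => by
      have ho : IsOpen {v : ℂ | 0 < v.re} := isOpen_lt continuous_const Complex.continuous_re
      rw [fderivWithin_of_isOpen ho hv, (hD v hv).hasFDerivAt.fderiv]
      ext; simp)
    (x := w) (y := 1) hw (by simp)
  have hone : binetJ 1 - binetLaplace 1 =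
      ((1 - Real.log (Real.sqrt (2 * Real.pi)) - realBinetLaplace 1 : ℝ) : ℂ) := by
    have := binetLaplace_ofReal 1
    rw [Complex.ofReal_one] at this
    rw [this, binetJ, logGamma_one]
    simp
  have hexp := exp_binetJ_sub_binetLaplace (w := 1) (by simp)
  rw [hone] at hexp
  have hzero : 1 - Real.log (Real.sqrt (2 * Real.pi)) - realBinetLaplace 1 = 0 := by
    rw [← Real.exp_eq_one_iff]
    exact_mod_cast hexp
  rw [hzero, Complex.ofReal_zero] at hone
  simp only [hone] at hconst
  exact sub_eq_zero.1 hconst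

/-! ### The Stieltjes form of J(w)/w and the sign of its imaginary part -/

theorem ofReal_sq_add_sq_ne_zero {w : ℂ} (hw : 0 < w.re) (t : ℝ) : w ^ 2 + (t : ℂ) ^ 2 ≠ 0 := by
  have h1 : w + t * I ≠ 0 := by
    intro h
    have := congrArg Complex.re h
    simp at this
    linarith
  have h2 : w - t * I ≠ 0 := by
    intro h
    have := congrArg Complex.re h
    simp at this
    linarith
  have h3 : w ^ 2 + (t : ℂ) ^ 2 = (w + t * I) * (w - t * I) := by
    ring_nf; simp
  rw [h3]
  exact mul_ne_zero h1 h2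

theorem integral_exp_neg_mul_mul_cos {w : ℂ} (hw : 0 < w.re) (t : ℝ) :
    ∫ s in Ioi (0 : ℝ), Complex.exp (-w * s) * Complex.cos (t * s) = w / (w ^ 2 + t ^ 2) := by
  have h1 : (-w + t * I).re < 0 := by simpa using hw
  have h2 : (-w - t * I).re < 0 := by simpa using hw
  have h1' : -w + t * I ≠ 0 := by rintro h; simp [h] at h1
  have h2' : -w - t * I ≠ 0 := by rintro h; simp [h] at h2
  have e : ∀ s : ℝ, Complex.exp (-w * s) * Complex.cos (t * s) =
      (Complex.exp ((-w + t * I) * s) + Complex.exp ((-w - t * I) * s)) * (1 / 2) := by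
    intro s
    rw [Complex.cos, show (-w + t * I) * (s : ℂ) = -w * s + t * s * I by ring,
      show (-w - t * I) * (s : ℂ) = -w * s + -(t * s) * I by ring, Complex.exp_add, Complex.exp_add]
    ring
  simp_rw [e]
  rw [integral_mul_const, integral_add (integrableOn_exp_mul_complex_Ioi h1 0)
    (integrableOn_exp_mul_complex_Ioi h2 0), integral_exp_mul_complex_Ioi h1,
    integral_exp_mul_complex_Ioi h2]
  have h3 := ofReal_sq_add_sq_ne_zero hw t
  have h4 : w ^ 2 + (t : ℂ) ^ 2 = (-w + t * I) * (-w - t * I) := by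
    ring_nf; simp
  rw [h4]
  simp only [Complex.ofReal_zero, mul_zero, Complex.exp_zero]
  field_simp
  ring

/-- Write 2 / (s² + a²) as (2/a) ∫ e^{-at} cos(ts) dt and apply Fubini; the s-integral is then w /
(w² + t²). On the right w enters only through w² apart from the factor w. -/
theorem integral_exp_neg_mul_div_sq_add_sq {w : ℂ} (hw : 0 < w.re) {a : ℝ} (ha : 0 < a) :
    ∫ s in Ioi (0 : ℝ), Complex.exp (-w * s) * ((2 / (s ^ 2 + a ^ 2) : ℝ) : ℂ) =
      w * ∫ t in Ioi (0 : ℝ), ((2 / a * Real.exp (-a * t) : ℝ) : ℂ) * (w ^ 2 + (t : ℂ) ^ 2)⁻¹ := by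
  have haC : (a : ℂ) ≠ 0 := by exact_mod_cast ha.ne'
  have h1 : ∀ s : ℝ, Complex.exp (-w * s) * ((2 / (s ^ 2 + a ^ 2) : ℝ) : ℂ) =
      ∫ t in Ioi (0 : ℝ), ((2 / a : ℝ) : ℂ) *
        (Complex.exp (-a * t) * Complex.exp (-w * s) * Complex.cos (t * s)) := by
    intro s
    have := integral_exp_neg_mul_mul_cos (w := a) (by simpa using ha) s
    have e : ∀ t : ℝ, ((2 / a : ℝ) : ℂ) *
        (Complex.exp (-a * t) * Complex.exp (-w * s) * Complex.cos (t * s)) =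
        ((2 / a : ℝ) : ℂ) * Complex.exp (-w * s) *
          (Complex.exp (-a * t) * Complex.cos (s * t)) := by
      intro t; rw [mul_comm (s : ℂ) t]; ring
    simp_rw [e]
    rw [integral_const_mul, this]
    push_cast
    rw [add_comm ((s : ℂ) ^ 2)]
    field_simp
  have h2 : ∀ t : ℝ, w * (((2 / a * Real.exp (-a * t) : ℝ) : ℂ) * (w ^ 2 + (t : ℂ) ^ 2)⁻¹) =
      ∫ s in Ioi (0 : ℝ), ((2 / a : ℝ) : ℂ) *
        (Complex.exp (-a * t) * Complex.exp (-w * s) * Complex.cos (t * s)) := by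
    intro t
    have e : ∀ s : ℝ, ((2 / a : ℝ) : ℂ) *
        (Complex.exp (-a * t) * Complex.exp (-w * s) * Complex.cos (t * s)) =
        ((2 / a : ℝ) : ℂ) * Complex.exp (-a * t) *
          (Complex.exp (-w * s) * Complex.cos (t * s)) := by
      intro s; ring
    simp_rw [e]
    rw [integral_const_mul, integral_exp_neg_mul_mul_cos hw t]
    push_cast
    ring
  rw [← integral_const_mul]
  simp_rw [h1, h2]
  refine integral_integral_swap ?_
  have hd := ((integrableOn_exp_mul_Ioi (neg_lt_zero.2 hw) 0).mul_prod
    (integrableOn_exp_mul_Ioi (neg_lt_zero.2 ha) 0)).const_mul (2 / a)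
  refine hd.mono' (Continuous.aestronglyMeasurable (by fun_prop)) (.of_forall fun p => ?_)
  simp only [Function.uncurry]
  have hcos : ‖Complex.cos (p.2 * p.1)‖ ≤ 1 := by
    rw [← Complex.ofReal_mul, ← Complex.ofReal_cos, Complex.norm_real]
    exact Real.abs_cos_le_one _
  have he := norm_exp_neg_mul_ofReal (a : ℂ) p.2
  rw [Complex.ofReal_re] at he
  rw [norm_mul, norm_mul, norm_mul, he, norm_exp_neg_mul_ofReal,
    Complex.norm_of_nonneg (by positivity)]
  have : Real.exp (-a * p.2) * Real.exp (-w.re * p.1) * ‖Complex.cos (p.2 * p.1)‖ ≤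
      Real.exp (-a * p.2) * Real.exp (-w.re * p.1) * 1 := by gcongr
  exact mul_le_mul_of_nonneg_left (by linarith) (by positivity)

theorem hasSum_binetLaplace {w : ℂ} (hw : 0 < w.re) :
    HasSum (fun k : ℕ => ∫ s in Ioi (0 : ℝ), Complex.exp (-w * s) *
      ((2 / (s ^ 2 + (2 * Real.pi * ((k : ℝ) + 1)) ^ 2) : ℝ) : ℂ)) (binetLaplace w) := by
  have hpi := Real.pi_pos
  have hexp := integrableOn_exp_mul_Ioi (neg_lt_zero.2 hw) 0
  have hle : ∀ (k : ℕ) (s : ℝ), ‖Complex.exp (-w * s) *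
      ((2 / (s ^ 2 + (2 * Real.pi * ((k : ℝ) + 1)) ^ 2) : ℝ) : ℂ)‖ ≤
      Real.exp (-w.re * s) * (2 / (2 * Real.pi * ((k : ℝ) + 1)) ^ 2) := by
    intro k s
    rw [norm_mul, norm_exp_neg_mul_ofReal, Complex.norm_of_nonneg (binetDensity_term_pos s k).le]
    exact mul_le_mul_of_nonneg_left (binetDensity_term_le s k) (Real.exp_pos _).le
  have hint : ∀ k : ℕ, IntegrableOn (fun s : ℝ => Complex.exp (-w * s) *
      ((2 / (s ^ 2 + (2 * Real.pi * ((k : ℝ) + 1)) ^ 2) : ℝ) : ℂ)) (Ioi 0) := by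
    intro k
    refine (hexp.mul_const _).mono' (Continuous.aestronglyMeasurable ?_) (.of_forall (hle k))
    have : Continuous fun s : ℝ => 2 / (s ^ 2 + (2 * Real.pi * ((k : ℝ) + 1)) ^ 2) :=
      continuous_const.div (by fun_prop) fun s => by positivity
    fun_prop
  have hsum := hasSum_integral_of_summable_integral_norm hint
    (((summable_binetDensity_bound.mul_left (∫ s in Ioi (0 : ℝ), Real.exp (-w.re * s)))).of_nonneg_of_le
      (fun k => integral_nonneg fun s => norm_nonneg _) fun k => by
        rw [← integral_mul_const]
        exact integral_mono (hint k).norm (hexp.mul_const _) (hle k))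
  have e : binetLaplace w = ∫ s in Ioi (0 : ℝ), ∑' k : ℕ, Complex.exp (-w * s) *
      ((2 / (s ^ 2 + (2 * Real.pi * ((k : ℝ) + 1)) ^ 2) : ℝ) : ℂ) := by
    simp_rw [tsum_mul_left, ← Complex.ofReal_tsum]
    rfl
  rw [e]
  exact hsum

/-- As t² is real, Im (w² + t²)⁻¹ = -Im(w²) / |w² + t²|², so P is the integral of a positive weight
over |w² + t²|². -/
theorem integral_exp_mul_inv_im {w : ℂ} (hw : 0 < w.re) {a : ℝ} (ha : 0 < a) :
    ∃ P : ℝ, 0 < P ∧ (∫ t in Ioi (0 : ℝ), ((2 / a * Real.exp (-a * t) : ℝ) : ℂ) *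
      (w ^ 2 + (t : ℂ) ^ 2)⁻¹).im = -P * (w ^ 2).im := by
  have hne := ofReal_sq_add_sq_ne_zero hw
  -- Both factors w ± it have real part Re w; the uniform bound gives integrability.
  have hlow : ∀ t : ℝ, w.re ^ 2 ≤ ‖w ^ 2 + (t : ℂ) ^ 2‖ := by
    intro t
    have h3 : w ^ 2 + (t : ℂ) ^ 2 = (w + t * I) * (w - t * I) := by
      ring_nf; simp
    have h1 : w.re ≤ ‖w + t * I‖ := by simpa using Complex.re_le_norm (w + t * I)
    have h2 : w.re ≤ ‖w - t * I‖ := by simpa using Complex.re_le_norm (w - t * I)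
    rw [h3, norm_mul, sq]
    gcongr
  have hexp := (integrableOn_exp_mul_Ioi (neg_lt_zero.2 ha) 0).const_mul (2 / a)
  have hint : IntegrableOn (fun t : ℝ => ((2 / a * Real.exp (-a * t) : ℝ) : ℂ) *
      (w ^ 2 + (t : ℂ) ^ 2)⁻¹) (Ioi 0) := by
    refine (hexp.mul_const ((w.re ^ 2)⁻¹)).mono' (Continuous.aestronglyMeasurable ?_)
      (.of_forall fun t => ?_)
    · have : Continuous fun t : ℝ => (w ^ 2 + (t : ℂ) ^ 2)⁻¹ :=
        Continuous.inv₀ (by fun_prop) hne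
      fun_prop
    · rw [norm_mul, Complex.norm_of_nonneg (by positivity), norm_inv]
      gcongr
      exact hlow t
  have hintP : IntegrableOn (fun t : ℝ => 2 / a * Real.exp (-a * t) *
      (Complex.normSq (w ^ 2 + (t : ℂ) ^ 2))⁻¹) (Ioi 0) := by
    refine (hexp.mul_const (((w.re ^ 2) ^ 2)⁻¹)).mono' (Continuous.aestronglyMeasurable ?_)
      (.of_forall fun t => ?_)
    · have : Continuous fun t : ℝ => (Complex.normSq (w ^ 2 + (t : ℂ) ^ 2))⁻¹ :=
        Continuous.inv₀ (Complex.continuous_normSq.comp (by fun_prop))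
          fun t => (Complex.normSq_pos.2 (hne t)).ne'
      fun_prop
    · have hp := Complex.normSq_pos.2 (hne t)
      rw [Real.norm_of_nonneg (by positivity), Complex.normSq_eq_norm_sq]
      gcongr
      exact hlow t
  refine ⟨∫ t in Ioi (0 : ℝ), 2 / a * Real.exp (-a * t) *
      (Complex.normSq (w ^ 2 + (t : ℂ) ^ 2))⁻¹, ?_, ?_⟩
  · have hpos : ∀ t : ℝ, 0 < 2 / a * Real.exp (-a * t) *
        (Complex.normSq (w ^ 2 + (t : ℂ) ^ 2))⁻¹ := fun t => by
      have hp := Complex.normSq_pos.2 (hne t)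
      positivity
    rw [setIntegral_pos_iff_support_of_nonneg_ae (.of_forall fun t => (hpos t).le) hintP,
      Function.support_eq_univ fun t => (hpos t).ne', univ_inter]
    simp
  · have := integral_im hint
    simp only [RCLike.im_to_complex] at this
    rw [← this, neg_mul, ← integral_mul_const, ← integral_neg]
    congr 1
    ext t
    rw [Complex.im_ofReal_mul, Complex.inv_im]
    have : (w ^ 2 + (t : ℂ) ^ 2).im = (w ^ 2).im := by
      rw [← Complex.ofReal_pow, Complex.add_im, Complex.ofReal_im, add_zero]
    rw [this]
    ring

/-- `J(w) / w` as a function of `w²` maps the upper half-plane to the lower one. -/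
theorem binetJ_div_im {w : ℂ} (hw : 0 < w.re) :
    ∃ P : ℝ, 0 < P ∧ (binetJ w / w).im = -P * (w ^ 2).im := by
  have hpi := Real.pi_pos
  have hw0 : w ≠ 0 := by rintro rfl; simp at hw
  choose P hP0 hP using fun k : ℕ =>
    integral_exp_mul_inv_im hw (a := 2 * Real.pi * ((k : ℝ) + 1)) (by positivity)
  have h1 := Complex.hasSum_im ((hasSum_binetLaplace hw).div_const w)
  have h2 : HasSum (fun k => -P k * (w ^ 2).im) (binetJ w / w).im := by
    rw [binetJ_eq_binetLaplace hw]
    refine h1.congr_fun fun k => ?_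
    rw [← hP k, integral_exp_neg_mul_div_sq_add_sq hw (by positivity), mul_div_cancel_left₀ _ hw0]
  by_cases hz : (w ^ 2).im = 0
  -- Both sides vanish here, so any positive constant serves.
  · refine ⟨1, one_pos, ?_⟩
    simp only [hz, mul_zero] at h2 ⊢
    exact h2.unique hasSum_zero
  -- Summability of the constants P k comes from dividing the convergent series of imaginary parts
  -- by Im(w²) ≠ 0.
  · have h3 : HasSum P (-((binetJ w / w).im / (w ^ 2).im)) := by
      have := (h2.div_const (w ^ 2).im).neg
      refine this.congr_fun fun k => ?_
      field_simp
    refine ⟨-((binetJ w / w).im / (w ^ 2).im), ?_, by rw [neg_neg, div_mul_cancel₀ _ hz]⟩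
    rw [← h3.tsum_eq]
    exact h3.summable.tsum_pos (fun k => (hP0 k).le) 0 (hP0 0)

/-! ### Positivity and monotonicity on the positive axis -/

theorem integrableOn_realBinetLaplace {x : ℝ} (hx : 0 < x) :
    IntegrableOn (fun s : ℝ => Real.exp (-x * s) * binetDensity s) (Ioi 0) := by
  have := (integrableOn_binetLaplace (w := x) (by simpa using hx)).re
  refine this.congr (.of_forall fun s => ?_)
  simp only [RCLike.re_to_complex, Complex.re_mul_ofReal]
  rw [← Complex.ofReal_neg, ← Complex.ofReal_mul, Complex.exp_ofReal_re]

theorem realBinetLaplace_pos {x : ℝ} (hx : 0 < x) : 0 < realBinetLaplace x := by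
  have hpos : ∀ s : ℝ, 0 < Real.exp (-x * s) * binetDensity s := fun s =>
    mul_pos (Real.exp_pos _) (binetDensity_pos s)
  rw [realBinetLaplace, setIntegral_pos_iff_support_of_nonneg_ae
    (.of_forall fun s => (hpos s).le) (integrableOn_realBinetLaplace hx),
    Function.support_eq_univ fun s => (hpos s).ne', univ_inter]
  simp

theorem realBinetLaplace_anti {x y : ℝ} (hx : 0 < x) (hxy : x ≤ y) :
    realBinetLaplace y ≤ realBinetLaplace x := by
  refine setIntegral_mono_on (integrableOn_realBinetLaplace (hx.trans_le hxy))
    (integrableOn_realBinetLaplace hx) measurableSet_Ioi fun s hs => ?_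
  have hs0 : 0 < s := hs
  have := (binetDensity_pos s).le
  gcongr

theorem binetJ_ofReal {x : ℝ} (hx : 0 < x) : binetJ x = (realBinetLaplace x : ℂ) := by
  rw [binetJ_eq_binetLaplace (by simpa using hx), binetLaplace_ofReal]

theorem realBinetLaplace_div_strictAnti {x y : ℝ} (hx : 0 < x) (hxy : x < y) :
    realBinetLaplace y / y < realBinetLaplace x / x :=
  div_lt_div₀' (realBinetLaplace_anti hx hxy.le) hxy (realBinetLaplace_pos hx) hx

theorem continuousOn_realBinetLaplace : ContinuousOn realBinetLaplace (Ioi 0) := by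
  intro x hx
  have h : ContinuousAt (fun x : ℝ => (binetLaplace x).re) x :=
    Complex.continuous_re.continuousAt.comp
      ((differentiableAt_binetLaplace (w := x) (by simpa using hx)).continuousAt.comp
        Complex.continuous_ofReal.continuousAt)
  simp only [binetLaplace_ofReal, Complex.ofReal_re] at h
  exact h.continuousWithinAt

/-! ### Reality and existence of solutions -/

theorem re_cpow_half_pos {z : ℂ} (hz : z ≠ 0) (harg : |z.arg| < Real.pi) :
    0 < (z ^ (1 / 2 : ℂ)).re := by
  obtain ⟨h1, h2⟩ := abs_lt.1 harg
  rw [Complex.cpow_def_of_ne_zero hz, Complex.exp_re]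
  have : (Complex.log z * (1 / 2)).im = z.arg / 2 := by
    rw [show (1 / 2 : ℂ) = ((1 / 2 : ℝ) : ℂ) by push_cast; rfl, Complex.im_mul_ofReal,
      Complex.log_im]
    ring
  rw [this]
  exact mul_pos (Real.exp_pos _) (Real.cos_pos_of_mem_Ioo ⟨by linarith, by linarith⟩)

theorem cpow_half_sq (z : ℂ) : (z ^ (1 / 2 : ℂ)) ^ 2 = z := by
  simp

theorem ofReal_cpow_half {x : ℝ} (hx : 0 < x) : (x : ℂ) ^ (1 / 2 : ℂ) = (Real.sqrt x : ℂ) := by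
  rw [Real.sqrt_eq_rpow, Complex.ofReal_cpow hx.le]
  push_cast; rfl

theorem ofReal_mem_binetSolutions {b c x : ℝ} (hx : 0 < x) : (x : ℂ) ∈ binetSolutions b c ↔
    realBinetLaplace (Real.sqrt x) / Real.sqrt x = b * x + c := by
  have h1 : (x : ℂ).arg = 0 := Complex.arg_ofReal_of_nonneg hx.le
  have h2 : (x : ℂ) ≠ 0 := by exact_mod_cast hx.ne'
  rw [binetSolutions, Set.mem_ofPred_eq, h1, ofReal_cpow_half hx, binetJ_ofReal (Real.sqrt_pos.2 hx)]
  simp only [h2, ne_eq, not_false_eq_true, abs_zero, Real.pi_pos, true_and]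
  rw [sub_sub, sub_eq_zero]
  exact_mod_cast Iff.rfl

/-- The imaginary part of the equation is -(P + b) Im z = 0 with P + b > 0; a negative real has
argument π and is excluded by the cut. -/
theorem pos_ofReal_of_mem_binetSolutions {b c : ℝ} (hb : 0 ≤ b) {z : ℂ}
    (hz : z ∈ binetSolutions b c) : 0 < z.re ∧ z = (z.re : ℂ) := by
  obtain ⟨hz0, harg, heq⟩ := hz
  obtain ⟨P, hP0, hP⟩ := binetJ_div_im (re_cpow_half_pos hz0 harg)
  rw [cpow_half_sq] at hP
  have him := congrArg Complex.im heq
  rw [Complex.sub_im, Complex.sub_im, hP, Complex.im_ofReal_mul, Complex.ofReal_im,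
    Complex.zero_im] at him
  have hzim : z.im = 0 := by
    have : (P + b) * z.im = 0 := by linear_combination -him
    exact (mul_eq_zero.1 this).resolve_left (by positivity)
  have hzre : z = (z.re : ℂ) := Complex.ext (by simp) (by simpa using hzim)
  refine ⟨?_, hzre⟩
  by_contra hneg
  have hne : z.re ≠ 0 := fun h => hz0 (by rw [hzre, h, Complex.ofReal_zero])
  have hlt : z.re < 0 := lt_of_le_of_ne (not_lt.1 hneg) hne
  rw [hzre, Complex.arg_ofReal_of_neg hlt, abs_of_pos Real.pi_pos] at harg
  exact lt_irrefl _ harg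

/-- Intermediate value theorem in y = √x. Monotonicity compares J(y)/y with m/y, where m = J(1): it
is at least m/y for y ≤ 1 and at most m/y for y ≥ 1. -/
theorem exists_realBinetLaplace_div_eq {b c : ℝ} (hb : 0 ≤ b)
    (h : 0 < b ∨ (b = 0 ∧ 0 < c)) :
    ∃ y : ℝ, 0 < y ∧ realBinetLaplace y / y = b * y ^ 2 + c := by
  have hJ1 := realBinetLaplace_pos one_pos
  set m := realBinetLaplace 1 with hm
  set f : ℝ → ℝ := fun y => realBinetLaplace y / y - (b * y ^ 2 + c) with hf
  obtain ⟨u, hu0, hu1, hu⟩ : ∃ u : ℝ, 0 < u ∧ u ≤ 1 ∧ 0 ≤ f u := by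
    have hden : 0 < b + |c| + m := by positivity
    -- Chosen so that m/u = b + |c| + m, which exceeds b u² + c for u ≤ 1.
    refine ⟨m / (b + |c| + m), by positivity, (div_le_one hden).2 (by linarith [abs_nonneg c]), ?_⟩
    set u := m / (b + |c| + m) with hu
    have hu0 : 0 < u := by positivity
    have hu1 : u ≤ 1 := (div_le_one hden).2 (by linarith [abs_nonneg c])
    have h1 : m / u ≤ realBinetLaplace u / u := by
      gcongr
      exact realBinetLaplace_anti hu0 hu1
    have h2 : m / u = b + |c| + m := by rw [hu]; field_simp
    have h3 : b * u ^ 2 ≤ b * 1 := by gcongr; exact pow_le_one₀ hu0.le hu1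
    have h4 := le_abs_self c
    simp only [hf]
    linarith
  obtain ⟨v, hv1, hv⟩ : ∃ v : ℝ, 1 ≤ v ∧ f v ≤ 0 := by
    have hbound : ∀ v : ℝ, 1 ≤ v → realBinetLaplace v / v ≤ m / v := fun v hv => by
      gcongr
      exact realBinetLaplace_anti one_pos hv
    rcases h with hb0 | ⟨rfl, hc⟩
    -- Then b v² + c ≥ b v + c ≥ m ≥ m/v.
    · set v := 1 + (m + |c|) / b with hv
      have hq : 0 ≤ (m + |c|) / b := by positivity
      have hv1 : 1 ≤ v := by linarith
      refine ⟨v, hv1, ?_⟩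
      have h1 : m / v ≤ m := div_le_self hJ1.le hv1
      have h2 : b * v = b + (m + |c|) := by rw [hv]; field_simp
      have h3 : b * v ≤ b * v ^ 2 := by gcongr; nlinarith
      have h4 := neg_abs_le c
      have h5 := hbound v hv1
      simp only [hf]
      linarith
    -- Then c v = c + m ≥ m, that is, m/v ≤ c.
    · set v := 1 + m / c with hv
      have hq : 0 < m / c := by positivity
      have hv1 : 1 ≤ v := by linarith
      refine ⟨v, hv1, ?_⟩
      have h1 : m / v ≤ c := by
        rw [div_le_iff₀ (by linarith), hv, mul_add, mul_div_cancel₀ _ hc.ne']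
        linarith
      have h5 := hbound v hv1
      simp only [hf]
      linarith
  have hsub : Icc u v ⊆ Ioi 0 := fun y hy => hu0.trans_le hy.1
  have hcont : ContinuousOn f (Icc u v) :=
    ((continuousOn_realBinetLaplace.mono hsub).div continuousOn_id
      fun y hy => (hsub hy).ne').sub (by fun_prop)
  obtain ⟨y, hy, hy0⟩ := intermediate_value_Icc' (hu1.trans hv1) hcont ⟨hv, hu⟩
  exact ⟨y, hsub hy, sub_eq_zero.1 hy0⟩

end

theorem mainTheorem11 :
    (∀ b c : ℝ, 0 ≤ b →
      ((0 < b ∨ (b = 0 ∧ 0 < c)) → ∃ x : ℝ, 0 < x ∧ binetSolutions b c = {(x : ℂ)}) ∧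
      (¬ (0 < b ∨ (b = 0 ∧ 0 < c)) → binetSolutions b c = ∅)) ∧
    (∀ z : ℂ, z ≠ 0 → |z.arg| < Real.pi / 2 → binetJ z ≠ 0) := by
  refine ⟨fun b c hb => ⟨fun h => ?_, fun h => ?_⟩, fun z hz harg hJ => ?_⟩
  · obtain ⟨y, hy0, hy⟩ := exists_realBinetLaplace_div_eq hb h
    have hy2 : 0 < y ^ 2 := by positivity
    refine ⟨y ^ 2, hy2, Set.eq_singleton_iff_unique_mem.2 ⟨?_, fun z hz => ?_⟩⟩
    · rw [ofReal_mem_binetSolutions hy2, Real.sqrt_sq hy0.le, hy]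
    · obtain ⟨hx, hzx⟩ := pos_ofReal_of_mem_binetSolutions hb hz
      rw [hzx, ofReal_mem_binetSolutions hx] at hz
      have hs := Real.sqrt_pos.2 hx
      have hsq := Real.sq_sqrt hx.le
      rw [hzx, ← hsq]
      congr 2
      -- Uniqueness: the left side of the equation strictly decreases while b x + c does not
      -- decrease.
      rcases lt_trichotomy (Real.sqrt z.re) y with hlt | heq | hgt
      · have h1 := realBinetLaplace_div_strictAnti hs hlt
        have h2 : b * z.re ≤ b * y ^ 2 := by rw [← hsq]; gcongr
        linarith
      · exact heq
      · have h1 := realBinetLaplace_div_strictAnti hy0 hgt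
        have h2 : b * y ^ 2 ≤ b * z.re := by rw [← hsq]; gcongr
        linarith
  · refine Set.eq_empty_of_forall_notMem fun z hz => ?_
    obtain ⟨hx, hzx⟩ := pos_ofReal_of_mem_binetSolutions hb hz
    rw [hzx, ofReal_mem_binetSolutions hx] at hz
    have hs := Real.sqrt_pos.2 hx
    have hpos := div_pos (realBinetLaplace_pos hs) hs
    push Not at h
    have hb0 : b = 0 := le_antisymm h.1 hb
    rw [hz, hb0, zero_mul, zero_add] at hpos
    -- A solution would make the positive number J(√x)/√x equal to c ≤ 0.
    exact absurd hpos (not_lt.2 (h.2 hb0))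
  · have hre : 0 < z.re := by
      rcases Complex.abs_arg_lt_pi_div_two_iff.1 harg with h | h
      · exact h
      · exact absurd h hz
    obtain ⟨P, hP0, hP⟩ := binetJ_div_im hre
    rw [hJ, zero_div, Complex.zero_im] at hP
    have him : z.im = 0 := by
      have h1 : (z ^ 2).im = 2 * z.re * z.im := by
        rw [sq, Complex.mul_im]; ring
      rw [h1] at hP
      have h2 : (P * (2 * z.re)) * z.im = 0 := by linear_combination hP
      exact (mul_eq_zero.1 h2).resolve_left (by positivity)
    have hzre : z = (z.re : ℂ) := Complex.ext (by simp) (by simpa using him)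
    rw [hzre, binetJ_ofReal hre] at hJ
    exact (realBinetLaplace_pos hre).ne' (by exact_mod_cast hJ)
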